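/- Let $n \equiv 2 \pmod 4$. The $n$-dimensional simplified shuffle-cube $SSQ_n$ is the graph, with certain $n$-bit binary strings $u = u_{n-1}u_{n-2}\cdots u_1u_0$ as vertices, defined recursively as follows. $SSQ_2$ is the hypercube $Q_2$ on all four $2$-bit strings (two strings are adjacent iff they differ in exactly one bit). For $n > 2$, the vertices of $SSQ_n$ are the strings $u$ whose prefix $p_4(u) = u_{n-1}u_{n-2}u_{n-3}u_{n-4}$ satisfies $u_{n-1} = u_{n-2}$ and whose suffix $s_{n-4}(u) = u_{n-5}\cdots u_0$ is a vertex of $SSQ_{n-4}$. Two vertices $u, v$ with $p_4(u) = p_4(v)$ are adjacent iff $s_{n-4}(u)$ and $s_{n-4}(v)$ are adjacent in $SSQ_{n-4}$; two vertices $u, v$ with $p_4(u) \neq p_4(v)$ are adjacent iff $s_{n-4}(u) = s_{n-4}(v)$ and $p_4(u) \oplus p_4(v) \in \{1111, 0001, 0010, 0011\}$, where $\oplus$ is bitwise addition modulo $2$. **Theorem 1.** For every $n \equiv 2 \pmod 4$ with $n \geq 6$, the graph $SSQ_n$ has exactly $2^{(3n+2)/4}$ vertices and is vertex-pancyclic: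 each vertex of $SSQ_n$ lies on a cycle of every length $l$ with $3 \leq l \leq 2^{(3n+2)/4}$. -/

import Mathlib

/-- `bitPrefix u` is the 4-prefix `u_{n+3} u_{n+2} u_{n+1} u_n` of the `(n+4)`-bit string
`u = u_{n+3} ⋯ u_1 u_0`, written from left to right. Bit `u_i` is the value of `u` at `i`. -/
def bitPrefix {n : ℕ} (u : Fin (n + 4) → ZMod 2) : Fin 4 → ZMod 2 :=
  ![u (Fin.natAdd n 3), u (Fin.natAdd n 2), u (Fin.natAdd n 1), u (Fin.natAdd n 0)]

/-- `bitSuffix u` is the `n`-suffix `u_{n-1} ⋯ u_1 u_0` of the `(n+4)`-bit string `u`. -/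
def bitSuffix {n : ℕ} (u : Fin (n + 4) → ZMod 2) : Fin n → ZMod 2 :=
  fun i => u (Fin.castAdd 4 i)

/-- The set `V₀₀ = {1111, 0001, 0010, 0011}` of 4-bit strings, written from left to right. -/
def V00 : Set (Fin 4 → ZMod 2) :=
  {![1, 1, 1, 1], ![0, 0, 0, 1], ![0, 0, 1, 0], ![0, 0, 1, 1]}

/-- The `n`-bit strings that label the vertices of `SSQ_n`: all 2-bit strings for `n = 2`, and
for `n + 4` the strings whose 4-prefix `i₁i₂i₃i₄` satisfies `i₁i₂ ∈ {00, 11}` and whose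
`n`-suffix labels a vertex of `SSQ_n`. There are none if `n` is not congruent to 2 mod 4. -/
def IsSSQLabel : (n : ℕ) → (Fin n → ZMod 2) → Prop
  | 0, _ => False
  | 1, _ => False
  | 2, _ => True
  | 3, _ => False
  | n + 4, u => bitPrefix u 0 = bitPrefix u 1 ∧ IsSSQLabel n (bitSuffix u)

/-- Adjacency of labels in `SSQ_n`. For `n = 2` this is the adjacency of the hypercube `Q_2`.
For `n + 4`, two labels in the same subcube are adjacent iff their suffixes are adjacent in
`SSQ_n`, and two labels in different subcubes are adjacent iff they have the same suffix and
the bitwise sum mod 2 of their prefixes lies in `V₀₀`. -/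
def SSQAdj : (n : ℕ) → (Fin n → ZMod 2) → (Fin n → ZMod 2) → Prop
  | 0, _, _ => False
  | 1, _, _ => False
  | 2, u, v => hammingDist u v = 1
  | 3, _, _ => False
  | n + 4, u, v =>
      (bitPrefix u = bitPrefix v ∧ SSQAdj n (bitSuffix u) (bitSuffix v)) ∨
      (bitPrefix u ≠ bitPrefix v ∧ bitSuffix u = bitSuffix v ∧ bitPrefix u + bitPrefix v ∈ V00)

theorem SSQAdj.symm : ∀ (n : ℕ) (u v : Fin n → ZMod 2), SSQAdj n u v → SSQAdj n v u
  | 0, _, _, h => h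
  | 1, _, _, h => h
  | 2, u, v, h => by
      rw [SSQAdj] at h ⊢
      rwa [hammingDist_comm]
  | 3, _, _, h => h
  | n + 4, u, v, h => by
      rw [SSQAdj] at h ⊢
      rcases h with ⟨h1, h2⟩ | ⟨h1, h2, h3⟩
      · exact Or.inl ⟨h1.symm, SSQAdj.symm n _ _ h2⟩
      · exact Or.inr ⟨h1.symm, h2.symm, by rwa [add_comm]⟩

theorem SSQAdj.irrefl : ∀ (n : ℕ) (u : Fin n → ZMod 2), ¬ SSQAdj n u u
  | 0, _, h => h
  | 1, _, h => h
  | 2, u, h => by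
      rw [SSQAdj, hammingDist_self] at h
      exact zero_ne_one h
  | 3, _, h => h
  | n + 4, u, h => by
      rw [SSQAdj] at h
      rcases h with ⟨_, h2⟩ | ⟨h1, _⟩
      · exact SSQAdj.irrefl n _ h2
      · exact h1 rfl

/-- The vertex set of the simplified shuffle-cube `SSQ_n`. -/
abbrev SSQVertex (n : ℕ) : Type := {u : Fin n → ZMod 2 // IsSSQLabel n u}

/-- The `n`-dimensional simplified shuffle-cube `SSQ_n` (for `n` congruent to 2 mod 4). -/
def SSQ (n : ℕ) : SimpleGraph (SSQVertex n) where
  Adj u v := SSQAdj n u.1 v.1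
  symm := ⟨fun u v h => SSQAdj.symm n u.1 v.1 h⟩
  loopless := ⟨fun u h => SSQAdj.irrefl n u.1 h⟩

/-- A finite graph is vertex-pancyclic if each vertex lies on a cycle of every length `l` with
`3 ≤ l ≤ |V|`. A cycle through `u` is given as a closed walk that starts at `u`. -/
def IsVertexPancyclic {V : Type*} [Finite V] (G : SimpleGraph V) : Prop :=
  ∀ (u : V) (l : ℕ), 3 ≤ l → l ≤ Nat.card V → ∃ c : G.Walk u u, c.IsCycle ∧ c.length = l

open SimpleGraph

/-! Each group of four bits contributes a factor `K₂ □ K₄`, so `SSQ n □ K₂ □ K₄` spans `SSQ (n + 4)`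
(`SSQ.ofBoxProd`). A Hamiltonian path of `SSQ n`, doubled across `K₂`, becomes a Hamiltonian path of
`SSQ n □ K₂`; over it, `exists_isPath_boxProd_top` joins the ends of one `K₄`-edge by paths of all
orders. The largest order renews the induction; closing the path with that edge gives cycles of all
lengths. Adjacency is invariant under translation by labels, so one vertex suffices. -/

/-! ### Paths in box products -/

/-- A path between two points of a column of `G □ H` extends by one step at both ends into an
adjacent column which it does not meet. -/
theorem exists_isPath_boxProd_extend {V W : Type*} {G : SimpleGraph V} {H : SimpleGraph W}
    {v w : V} (h : G.Adj v w) {x y : W} (hxy : x ≠ y) (q : (G □ H).Walk (w, x) (w, y))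
    (hq : q.IsPath) (hv : ∀ z ∈ q.support, z.1 ≠ v) :
    ∃ r : (G □ H).Walk (v, x) (v, y), r.IsPath ∧ r.length = q.length + 2 ∧
      ∀ z ∈ r.support, z ∈ q.support ∨ z = (v, x) ∨ z = (v, y) := by
  have h₁ : (G □ H).Adj (v, x) (w, x) := boxProd_adj.2 (Or.inl ⟨h, rfl⟩)
  have h₂ : (G □ H).Adj (w, y) (v, y) := boxProd_adj.2 (Or.inl ⟨h.symm, rfl⟩)
  refine ⟨Walk.cons h₁ (q.concat h₂), ?_, by simp, ?_⟩
  · rw [Walk.cons_isPath_iff]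
    refine ⟨hq.concat (fun hm => hv _ hm rfl) h₂, ?_⟩
    simp only [Walk.support_concat, List.mem_append, List.mem_singleton,
      Prod.mk.injEq, true_and, not_or]
    exact ⟨fun hm => hv _ hm rfl, hxy⟩
  · intro z hz
    simp only [Walk.support_cons, Walk.support_concat, List.mem_cons,
      List.mem_append, List.not_mem_nil, or_false] at hz
    tauto

/-- Going up along a path of `G` and back in the other layer. -/
theorem exists_isPath_boxProd_double {V W : Type*} {G : SimpleGraph V} {H : SimpleGraph W}
    {x y : W} (hxy : H.Adj x y) {v w : V} (p : G.Walk v w) (hp : p.IsPath) :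
    ∃ q : (G □ H).Walk (v, x) (v, y), q.IsPath ∧ q.length = 2 * p.length + 1 ∧
      ∀ z ∈ q.support, z.1 ∈ p.support := by
  induction p with
  | nil =>
    rename_i v
    have h : (G □ H).Adj (v, x) (v, y) := boxProd_adj.2 (Or.inr ⟨hxy, rfl⟩)
    refine ⟨h.toWalk, Walk.IsPath.of_adj h, by simp, ?_⟩
    simp
  | cons h p ih =>
    rw [Walk.cons_isPath_iff] at hp
    obtain ⟨q, hq, hl, hs⟩ := ih hp.1
    obtain ⟨r, hr, hrl, hrs⟩ := exists_isPath_boxProd_extend h hxy.ne q hq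
      fun z hz e => hp.2 (e ▸ hs z hz)
    refine ⟨r, hr, by simp [hrl, hl]; ring, fun z hz => ?_⟩
    rcases hrs z hz with h | rfl | rfl
    · simp [hs z h]
    · simp
    · simp

/-- In `G □ K₄`, the endpoints of an edge of the first column over a path of `G` are joined by
paths with any number of vertices from `2` up to the number of vertices over the path. -/
theorem exists_isPath_boxProd_top {V W : Type*} [Fintype W] {G : SimpleGraph V}
    (hW : Fintype.card W = 4) {v w : V} (p : G.Walk v w) (hp : p.IsPath) {x y : W} (hxy : x ≠ y)
    {m : ℕ} (hm : 2 ≤ m) (hm' : m ≤ 4 * (p.length + 1)) :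
    ∃ q : (G □ (⊤ : SimpleGraph W)).Walk (v, x) (v, y), q.IsPath ∧ q.length + 1 = m ∧
      ∀ z ∈ q.support, z.1 ∈ p.support := by
  classical
  have hcol : ∀ (v : V) {a b : W}, a ≠ b → (G □ (⊤ : SimpleGraph W)).Adj (v, a) (v, b) :=
    fun v a b hab => boxProd_adj.2 (Or.inr ⟨hab, rfl⟩)
  have havoid : ∀ a b c : W, ∃ d, d ≠ a ∧ d ≠ b ∧ d ≠ c := fun a b c => by
    have h : ({a, b, c} : Finset W).card < Fintype.card W := by
      have := Finset.card_le_three (a := a) (b := b) (c := c)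
      omega
    obtain ⟨d, hd⟩ := Finset.exists_mem_notMem_of_card_lt_card
      (t := (Finset.univ : Finset W)) (by simpa using h)
    exact ⟨d, by simpa using hd⟩
  induction p generalizing x y m with
  | nil =>
    rename_i v
    obtain ⟨z, hzx, hzy, -⟩ := havoid x y y
    obtain ⟨t, htx, hty, htz⟩ := havoid x y z
    simp only [Walk.length_nil] at hm'
    obtain rfl | rfl | rfl : m = 2 ∨ m = 3 ∨ m = 4 := by omega
    · exact ⟨.cons (hcol v hxy) .nil, by simp [hxy], by simp, by simp⟩
    · exact ⟨.cons (hcol v hzx.symm) (.cons (hcol v hzy) .nil),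
        by simp [hxy, hzx.symm, hzy], by simp, by simp⟩
    · exact ⟨.cons (hcol v hzx.symm) (.cons (hcol v htz.symm) (.cons (hcol v hty) .nil)),
        by simp [hxy, hzx.symm, hzy, htx.symm, hty, htz.symm], by simp, by simp⟩
  | cons h p ih =>
    rename_i v w _
    rw [Walk.cons_isPath_iff] at hp
    have hext : ∀ {a b : W}, a ≠ b → ∀ {k : ℕ}, 2 ≤ k → k ≤ 4 * (p.length + 1) →
        ∃ r : (G □ (⊤ : SimpleGraph W)).Walk (v, a) (v, b), r.IsPath ∧ r.length + 1 = k + 2 ∧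
          (∀ z ∈ r.support, z.1 ∈ p.support ∨ z = (v, a) ∨ z = (v, b)) := by
      intro a b hab k hk hk'
      obtain ⟨q, hq, hl, hs⟩ := ih hp.1 hab hk hk'
      obtain ⟨r, hr, hrl, hrs⟩ := exists_isPath_boxProd_extend h hab q hq
        fun z hz e => hp.2 (e ▸ hs z hz)
      exact ⟨r, hr, by omega, fun z hz => (hrs z hz).imp_left (hs z)⟩
    have hout : ∀ {a b c : W} {r : (G □ (⊤ : SimpleGraph W)).Walk (v, a) (v, b)},
        (∀ z ∈ r.support, z.1 ∈ p.support ∨ z = (v, a) ∨ z = (v, b)) → c ≠ a → c ≠ b →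
          (v, c) ∉ r.support := by
      intro a b c r hr hca hcb hc
      rcases hr _ hc with h | h | h
      · exact hp.2 h
      · exact hca (congrArg Prod.snd h)
      · exact hcb (congrArg Prod.snd h)
    have hsup : ∀ {a b : W} {z : V × W}, (z.1 ∈ p.support ∨ z = (v, a) ∨ z = (v, b)) →
        z.1 ∈ (Walk.cons h p).support := by
      rintro a b z (h | rfl | rfl)
      · simp [h]
      · simp
      · simp
    rw [Walk.length_cons] at hm'
    obtain ⟨z, hzx, hzy, -⟩ := havoid x y y
    obtain ⟨t, htx, hty, htz⟩ := havoid x y z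
    -- Extending a path over the tail adds two vertices of the first column. The two largest orders
    -- also need the remaining vertices `z` and `t` of that column.
    obtain rfl | rfl | h4 | h5 | h6 : m = 2 ∨ m = 3 ∨ (4 ≤ m ∧ m ≤ 4 * (p.length + 1) + 2) ∨
        m = 4 * (p.length + 1) + 3 ∨ m = 4 * (p.length + 1) + 4 := by omega
    · exact ⟨.cons (hcol v hxy) .nil, by simp [hxy], by simp, by simp⟩
    · exact ⟨.cons (hcol v hzx.symm) (.cons (hcol v hzy) .nil),
        by simp [hxy, hzx.symm, hzy], by simp, by simp⟩
    · obtain ⟨r, hr, hl, hs⟩ := hext hxy (k := m - 2) (by omega) (by omega)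
      exact ⟨r, hr, by omega, fun z hz => hsup (hs z hz)⟩
    · obtain ⟨r, hr, hl, hs⟩ := hext hzx.symm (k := m - 3) (by omega) (by omega)
      refine ⟨r.concat (hcol v hzy), hr.concat (hout hs hxy.symm hzy.symm) _, ?_, ?_⟩
      · rw [Walk.length_concat]; omega
      · intro c hc
        rw [Walk.support_concat, List.mem_append, List.mem_singleton] at hc
        rcases hc with hc | rfl
        · exact hsup (hs c hc)
        · simp
    · obtain ⟨r, hr, hl, hs⟩ := hext hzx.symm (k := m - 4) (by omega) (by omega)
      refine ⟨(r.concat (hcol v htz.symm)).concat (hcol v hty),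
        (hr.concat (hout hs htx htz) _).concat ?_ _, ?_, ?_⟩
      · rw [Walk.support_concat, List.mem_append, List.mem_singleton]
        rintro (hc | hc)
        · exact hout hs hxy.symm hzy.symm hc
        · exact hty (congrArg Prod.snd hc).symm
      · rw [Walk.length_concat, Walk.length_concat]; omega
      · intro c hc
        simp only [Walk.support_concat, List.mem_append,
          List.mem_singleton] at hc
        rcases hc with (hc | rfl) | rfl
        · exact hsup (hs c hc)
        · simp
        · simp

/-! ### Translations by labels -/

theorem isSSQLabel_add_four {n : ℕ} (u : Fin (n + 4) → ZMod 2) :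
    IsSSQLabel (n + 4) u ↔ bitPrefix u 0 = bitPrefix u 1 ∧ IsSSQLabel n (bitSuffix u) := by
  rw [IsSSQLabel]

theorem string_add_self {n : ℕ} (u : Fin n → ZMod 2) : u + u = 0 :=
  funext fun i => CharTwo.add_self_eq_zero (u i)

theorem bitPrefix_add {n : ℕ} (u v : Fin (n + 4) → ZMod 2) :
    bitPrefix (u + v) = bitPrefix u + bitPrefix v := by
  simp [bitPrefix]

theorem bitSuffix_add {n : ℕ} (u v : Fin (n + 4) → ZMod 2) :
    bitSuffix (u + v) = bitSuffix u + bitSuffix v := rfl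

theorem IsSSQLabel.add : ∀ (n : ℕ) {u v : Fin n → ZMod 2}, IsSSQLabel n u → IsSSQLabel n v →
    IsSSQLabel n (u + v)
  | 0, _, _, h, _ => h
  | 1, _, _, h, _ => h
  | 2, _, _, h, _ => h
  | 3, _, _, h, _ => h
  | n + 4, u, v, hu, hv => by
    rw [isSSQLabel_add_four] at hu hv ⊢
    rw [bitPrefix_add, bitSuffix_add, Pi.add_apply, Pi.add_apply, hu.1, hv.1]
    exact ⟨rfl, IsSSQLabel.add n hu.2 hv.2⟩

/-- Adjacency depends only on the sum of the two strings, which translation preserves in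
characteristic 2. -/
theorem SSQAdj.add_left : ∀ (n : ℕ) (w : Fin n → ZMod 2) {u v : Fin n → ZMod 2},
    SSQAdj n u v → SSQAdj n (w + u) (w + v)
  | 0, _, _, _, h => h
  | 1, _, _, _, h => h
  | 2, w, u, v, h => by
    rw [SSQAdj] at h ⊢
    simpa [hammingDist] using h
  | 3, _, _, _, h => h
  | n + 4, w, u, v, h => by
    rw [SSQAdj] at h ⊢
    simp only [bitPrefix_add, bitSuffix_add]
    rcases h with ⟨h₁, h₂⟩ | ⟨h₁, h₂, h₃⟩
    · exact Or.inl ⟨by rw [h₁], SSQAdj.add_left n _ h₂⟩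
    · refine Or.inr ⟨fun e => h₁ (add_left_cancel e), by rw [h₂], ?_⟩
      rwa [add_add_add_comm, string_add_self, zero_add]

/-- Translation by a label, as an endomorphism of `SSQ n`. -/
def SSQ.translate {n : ℕ} (w : SSQVertex n) : SSQ n →g SSQ n where
  toFun u := ⟨w.1 + u.1, w.2.add n u.2⟩
  map_rel' h := SSQAdj.add_left n w.1 h

theorem SSQ.translate_injective {n : ℕ} (w : SSQVertex n) :
    Function.Injective (SSQ.translate w) := fun _ _ h =>
  Subtype.ext (add_left_cancel (congrArg Subtype.val h))

theorem SSQ.exists_translate_eq {n : ℕ} (u v : SSQVertex n) :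
    ∃ w, SSQ.translate w u = v := by
  refine ⟨⟨v.1 + u.1, v.2.add n u.2⟩, Subtype.ext ?_⟩
  change v.1 + u.1 + u.1 = v.1
  rw [add_assoc, string_add_self, add_zero]

/-! ### The box product inside `SSQ (n + 4)` -/

/-- The string with prefix `aaβγ`, where `β = b + a` and `γ = c + a`, and suffix `s`. -/
def ssqString {n : ℕ} (s : Fin n → ZMod 2) (a b c : ZMod 2) : Fin (n + 4) → ZMod 2 :=
  -- Reversed, since index 0 is the lowest bit.
  Fin.append s ![c + a, b + a, a, a]

theorem bitSuffix_ssqString {n : ℕ} (s : Fin n → ZMod 2) (a b c : ZMod 2) :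
    bitSuffix (ssqString s a b c) = s := by
  ext i
  simp [bitSuffix, ssqString]

theorem bitPrefix_ssqString {n : ℕ} (s : Fin n → ZMod 2) (a b c : ZMod 2) :
    bitPrefix (ssqString s a b c) = ![a, a, b + a, c + a] := by
  simp [bitPrefix, ssqString]

theorem eq_of_bitPrefix_eq_of_bitSuffix_eq {n : ℕ} {u v : Fin (n + 4) → ZMod 2}
    (hp : bitPrefix u = bitPrefix v) (hs : bitSuffix u = bitSuffix v) : u = v := by
  ext i
  refine Fin.addCases (fun i => congrFun hs i) (fun i => ?_) i
  have h0 := congrFun hp 0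
  have h1 := congrFun hp 1
  have h2 := congrFun hp 2
  have h3 := congrFun hp 3
  fin_cases i
  exacts [h3, h2, h1, h0]

/-- Adding 1111 to the prefix flips `a` and fixes `b` and `c`; adding 0001, 0010 or 0011 fixes `a`
and realises every change of `(b, c)`. -/
theorem ssqAdj_ssqString {n : ℕ} {s t : Fin n → ZMod 2} {a b c a' b' c' : ZMod 2}
    (h : (SSQAdj n s t ∧ a = a' ∧ b = b' ∧ c = c') ∨
      (s = t ∧ a ≠ a' ∧ b = b' ∧ c = c') ∨ (s = t ∧ a = a' ∧ (b, c) ≠ (b', c'))) :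
    SSQAdj (n + 4) (ssqString s a b c) (ssqString t a' b' c') := by
  rw [SSQAdj]
  simp only [bitSuffix_ssqString, bitPrefix_ssqString, V00, Set.mem_insert_iff,
    Set.mem_singleton_iff]
  rcases h with ⟨h, rfl, rfl, rfl⟩ | ⟨rfl, h⟩ | ⟨rfl, h⟩
  · exact Or.inl ⟨rfl, h⟩
  all_goals
    refine Or.inr ?_
    rw [eq_self, true_and]
    revert a b c a' b' c'
    decide

/-- `SSQ n □ K₂ □ K₄` as a spanning subgraph of `SSQ (n + 4)`. -/
def SSQ.ofBoxProd (n : ℕ) :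
    ((SSQ n □ (⊤ : SimpleGraph (ZMod 2))) □ (⊤ : SimpleGraph (ZMod 2 × ZMod 2))) →g
      SSQ (n + 4) where
  toFun z := ⟨ssqString z.1.1.1 z.1.2 z.2.1 z.2.2, by
    rw [isSSQLabel_add_four, bitSuffix_ssqString, bitPrefix_ssqString]
    exact ⟨rfl, z.1.1.2⟩⟩
  map_rel' {z z'} h := by
    obtain ⟨⟨s, a⟩, b, c⟩ := z
    obtain ⟨⟨t, a'⟩, b', c'⟩ := z'
    apply ssqAdj_ssqString
    simp only [boxProd_adj, top_adj, Prod.mk.injEq] at h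
    rcases h with ⟨⟨h, rfl⟩ | ⟨h, rfl⟩, rfl, rfl⟩ | ⟨h, rfl, rfl⟩
    · exact Or.inl ⟨h, rfl, rfl, rfl⟩
    · exact Or.inr (Or.inl ⟨rfl, h, rfl, rfl⟩)
    · exact Or.inr (Or.inr ⟨rfl, rfl, h⟩)

theorem SSQ.ofBoxProd_bijective (n : ℕ) : Function.Bijective (SSQ.ofBoxProd n) := by
  constructor
  · rintro ⟨⟨s, a⟩, b, c⟩ ⟨⟨t, a'⟩, b', c'⟩ h
    have h := congrArg Subtype.val h
    have hs := congrArg bitSuffix h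
    have hp := congrArg bitPrefix h
    simp only [SSQ.ofBoxProd, RelHom.coeFn_mk, bitSuffix_ssqString] at hs
    simp only [SSQ.ofBoxProd, RelHom.coeFn_mk, bitPrefix_ssqString] at hp
    obtain rfl : a = a' := congrFun hp 0
    obtain rfl : b = b' := add_right_cancel (congrFun hp 2)
    obtain rfl : c = c' := add_right_cancel (congrFun hp 3)
    obtain rfl : s = t := Subtype.ext hs
    rfl
  · rintro ⟨u, hu⟩
    rw [isSSQLabel_add_four] at hu
    refine ⟨((⟨bitSuffix u, hu.2⟩, bitPrefix u 0),
      bitPrefix u 2 + bitPrefix u 0, bitPrefix u 3 + bitPrefix u 0), Subtype.ext ?_⟩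
    apply eq_of_bitPrefix_eq_of_bitSuffix_eq
    · simp only [SSQ.ofBoxProd, RelHom.coeFn_mk, bitPrefix_ssqString]
      ext i
      fin_cases i <;> simp [add_assoc, CharTwo.add_self_eq_zero, hu.1]
    · exact bitSuffix_ssqString _ _ _ _

/-! ### Number of vertices -/

theorem card_ssqVertex_add_four (n : ℕ) :
    Nat.card (SSQVertex (n + 4)) = 8 * Nat.card (SSQVertex n) := by
  rw [← Nat.card_congr (Equiv.ofBijective _ (SSQ.ofBoxProd_bijective n))]
  simp only [Nat.card_prod, Nat.card_zmod]
  ring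

theorem card_ssqVertex_two : Nat.card (SSQVertex 2) = 4 := by
  have e : SSQVertex 2 ≃ (Fin 2 → ZMod 2) := Equiv.subtypeUnivEquiv fun _ => trivial
  rw [Nat.card_congr e]
  simp

theorem card_ssqVertex (k : ℕ) : Nat.card (SSQVertex (4 * k + 2)) = 2 ^ (3 * k + 2) := by
  induction k with
  | zero => exact card_ssqVertex_two
  | succ k ih =>
    rw [show 4 * (k + 1) + 2 = 4 * k + 2 + 4 by ring, card_ssqVertex_add_four, ih]
    ring

/-! ### Hamiltonian paths and cycles -/

theorem exists_isPath_ssq_two :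
    ∃ (u v : SSQVertex 2) (p : (SSQ 2).Walk u v), p.IsPath ∧
      p.length + 1 = Nat.card (SSQVertex 2) := by
  have hadj : ∀ u v : Fin 2 → ZMod 2, hammingDist u v = 1 →
      (SSQ 2).Adj ⟨u, trivial⟩ ⟨v, trivial⟩ := fun u v h => by
    change SSQAdj 2 u v
    rwa [SSQAdj]
  refine ⟨_, _, .cons (hadj ![0, 0] ![0, 1] (by decide)) (.cons (hadj _ ![1, 1] (by decide))
    (.cons (hadj _ ![1, 0] (by decide)) .nil)), ?_, ?_⟩
  · simp only [Walk.cons_isPath_iff, Walk.support_cons, Walk.support_nil, List.mem_cons,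
      List.not_mem_nil, Walk.IsPath.nil]
    decide
  · simp [card_ssqVertex_two]

/-- If `SSQ n` has a Hamiltonian path, then in `SSQ (n + 4)` the endpoints of some edge are
joined by paths with any number of vertices between `2` and the order of the graph. -/
theorem exists_adj_forall_isPath_ssq_add_four {n : ℕ} {u v : SSQVertex n} (p : (SSQ n).Walk u v)
    (hp : p.IsPath) (hl : p.length + 1 = Nat.card (SSQVertex n)) :
    ∃ x y : SSQVertex (n + 4), (SSQ (n + 4)).Adj y x ∧
      ∀ m, 2 ≤ m → m ≤ Nat.card (SSQVertex (n + 4)) →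
        ∃ q : (SSQ (n + 4)).Walk x y, q.IsPath ∧ q.length + 1 = m := by
  have h01 : (⊤ : SimpleGraph (ZMod 2)).Adj 0 1 := by simp
  have hne : ((0, 0) : ZMod 2 × ZMod 2) ≠ (0, 1) := by simp
  obtain ⟨p', hp', hl', -⟩ := exists_isPath_boxProd_double h01 p hp
  refine ⟨SSQ.ofBoxProd n ((u, 0), (0, 0)), SSQ.ofBoxProd n ((u, 0), (0, 1)),
    (SSQ.ofBoxProd n).map_adj (boxProd_adj.2 (Or.inr ⟨hne.symm, rfl⟩)), fun m hm hm' => ?_⟩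
  rw [card_ssqVertex_add_four, ← hl] at hm'
  -- The doubled path has `2 * (p.length + 1)` vertices, so four layers reach all `8 * (p.length +
  -- 1)`.
  obtain ⟨q, hq, hql, -⟩ := exists_isPath_boxProd_top (by simp) p' hp' hne hm (by omega)
  exact ⟨q.map (SSQ.ofBoxProd n), hq.map (SSQ.ofBoxProd_bijective n).1,
    by rwa [Walk.length_map]⟩

theorem exists_isPath_ssq (k : ℕ) :
    ∃ (u v : SSQVertex (4 * k + 2)) (p : (SSQ (4 * k + 2)).Walk u v), p.IsPath ∧
      p.length + 1 = Nat.card (SSQVertex (4 * k + 2)) := by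
  induction k with
  | zero => exact exists_isPath_ssq_two
  | succ k ih =>
    obtain ⟨u, v, p, hp, hl⟩ := ih
    obtain ⟨x, y, -, h⟩ := exists_adj_forall_isPath_ssq_add_four p hp hl
    refine ⟨x, y, h _ ?_ le_rfl⟩
    rw [card_ssqVertex]
    exact (by norm_num : 2 ≤ 2 ^ 1).trans (Nat.pow_le_pow_right two_pos (by omega))

theorem isVertexPancyclic_ssq_add_four {n : ℕ} {u v : SSQVertex n} (p : (SSQ n).Walk u v)
    (hp : p.IsPath) (hl : p.length + 1 = Nat.card (SSQVertex n)) :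
    IsVertexPancyclic (SSQ (n + 4)) := by
  intro w l h3 hle
  obtain ⟨x, y, hadj, h⟩ := exists_adj_forall_isPath_ssq_add_four p hp hl
  obtain ⟨q, hq, hql⟩ := h l (by omega) hle
  obtain ⟨t, rfl⟩ := SSQ.exists_translate_eq y w
  refine ⟨(Walk.cons hadj q).map (SSQ.translate t), ?_, by simpa using hql⟩
  refine (Walk.isCycle_map_iff_of_injective (SSQ.translate_injective t)).2 ?_
  rw [Walk.cons_isCycle_iff]
  refine ⟨hq, fun hmem => ?_⟩
  -- A path containing the edge between its own ends has length one, but here the length is `l - 1 ≥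
  -- 2`.
  have := hq.length_eq_one_of_mem_edges (Sym2.eq_swap ▸ hmem)
  omega

theorem theorem1 (n : ℕ) (hmod : n ≡ 2 [MOD 4]) (hn : 6 ≤ n) :
    Nat.card (SSQVertex n) = 2 ^ ((3 * n + 2) / 4) ∧ IsVertexPancyclic (SSQ n) := by
  obtain ⟨k, rfl⟩ : ∃ k, n = 4 * k + 2 + 4 := by
    refine ⟨(n - 6) / 4, ?_⟩
    unfold Nat.ModEq at hmod
    omega
  constructor
  · rw [show 4 * k + 2 + 4 = 4 * (k + 1) + 2 by ring, card_ssqVertex]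
    congr 1
    omega
  · obtain ⟨u, v, p, hp, hl⟩ := exists_isPath_ssq k
    exact isVertexPancyclic_ssq_add_four p hp hl
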